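/- Let $d\ge 1$, let $\mu$ be Lebesgue measure on $\mathbb R^d$, and for $A\subset\mathbb R^d$, $t\ge 0$ let $B(A,t)$ be the set of points at distance at most $t$ from $A$. Let $S\subset\mathbb R^d$ be compact with volume function $V(t)=\mu(B(S,t))$, and let the polynomial reach of $S$ be $$\mathbf R=\sup\{t\ge 0:\ V\text{ is a polynomial of degree at most } d\text{ on }[0,t]\}\in[0,\infty].$$ Assume that $V(0)>0$, that $V$ has a finite right derivative at $0$, and that the limit $L_0(S)=\lim_{\varepsilon\to0^+}\mu(B(\partial S,\varepsilon))/(2\varepsilon)$ exists and is finite. Let $X_1,X_2,\dots$ be i.i.d. random points whose law $P_X$ is concentrated on $S$ and is standard with respect to Lebesgue measure: there are $\lambda,\delta>0$ with $P_X(B(x,\varepsilon)\cap S)\ge\delta\,\mu(B(x,\varepsilon))$ for all $x\in S$ and $0<\varepsilon\le\lambda$, where $B(x,\varepsilon)$ is the closed ball. Put $\aleph_n=\{X_1,\dots,X_n\}$ and $V_n(t)=\mu(B(\aleph_n,t))$; for a compact interval $I\subset[0,\infty)$ let $P^I_{n,m}$ be the best approximation of $V_n$ in $L^2(I)$ by polynomials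 of degree at most $m$. Fix a grid $0=r_0<r_1<\dots<r_K$, $K\ge1$, put $I_i=[0,r_i]$ for $1\le i\le K$ and $J_i=[r_i,r_K]$ for $1\le i\le K-1$, and for $\eta>0$ let $U_n=(\log n/n)^{\frac1{2d}-\eta}$. For a degree $\ell\ge d$ the algorithm computes $\widehat{\mathbf R}=\widehat{\mathbf R}(n,\ell,\eta)$ as follows. If $\|V_n-P^{I_1}_{n,d}\|_{L^2(I_1)}>U_n$, then $\widehat{\mathbf R}=0$. Otherwise let $$c_i=\frac{\|V_n-P^{I_i}_{n,d}\|_{L^2(I_i)}}{\|V_n-P^{J_i}_{n,\ell}\|_{L^2(J_i)}}\in[0,\infty],\qquad 1\le i\le K-1$$ (a positive number divided by $0$ is $\infty$, and $0/0=0$); then $\widehat{\mathbf R}=r_{i-1}$ for the first $i\in\{1,\dots,K-1\}$ with $c_i>1$, and $\widehat{\mathbf R}=r_{K-1}$ if there is no such $i$. Then: (H1) for every $\eta>0$, with probability one, for all $n$ large enough, $\|V_n-P^{I_i}_{n,d}\|_{L^2(I_i)}<U_n$ for all $i\in\{1,\dots,K\}$ with $I_i\subset[0,\mathbf R]$ (that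 is, $r_i\le\mathbf R$); (H2) for every $\varepsilon>0$ there is a non-random degree $\ell(\varepsilon)\ge d$ such that, with probability one, for every $\varepsilon>0$ and all $n$ large enough, $\|V_n-P^{J_i}_{n,\ell(\varepsilon)}\|_{L^2(J_i)}<\varepsilon$ for all $i=1,\dots,K-1$; and consequently there is a non-random $\ell_0\ge d$ such that, for every $\ell\ge\ell_0$ and every $\eta>0$, with probability one, $\widehat{\mathbf R}(n,\ell,\eta)\le\mathbf R$ for all $n$ large enough. -/

import Mathlib

open MeasureTheory ProbabilityTheory Filter Topology Polynomial

noncomputable section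

/-- `ℝ^d` with its Euclidean norm. -/
abbrev Euc (d : ℕ) : Type := EuclideanSpace ℝ (Fin d)

/-- The volume function `V(t) = μ(B(A, t))` of a set `A`, where `B(A, t)` is the closed parallel set
(the set of points at distance at most `t` from `A`) and `μ` is Lebesgue measure. -/
def volFun {d : ℕ} (A : Set (Euc d)) (t : ℝ) : ℝ :=
  (volume (Metric.cthickening t A)).toReal

/-- `V` is a polynomial function of degree at most `m` on `[0, t]`. -/
def IsPolyOn (V : ℝ → ℝ) (m : ℕ) (t : ℝ) : Prop :=
  ∃ p : ℝ[X], p.natDegree ≤ m ∧ ∀ s ∈ Set.Icc 0 t, V s = p.eval s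

/-- The polynomial reach of `S ⊆ ℝ^d`; it may be `+∞` (for instance for convex bodies). -/
def polyReach {d : ℕ} (S : Set (Euc d)) : EReal :=
  sSup ((fun t : ℝ => (t : EReal)) '' {t : ℝ | 0 ≤ t ∧ IsPolyOn (volFun S) d t})

/-- `S` is standard with respect to the Borel measure `ν`. -/
def IsStandard {d : ℕ} (S : Set (Euc d)) (ν : Measure (Euc d)) : Prop :=
  ∃ lam > (0 : ℝ), ∃ δ > (0 : ℝ), ∀ x ∈ S, ∀ ε : ℝ, 0 < ε → ε ≤ lam →
    ENNReal.ofReal δ * volume (Metric.closedBall x ε) ≤ ν (Metric.closedBall x ε ∩ S)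

/-- `L` is the (two-sided) Minkowski content `L_0(S) = lim μ(B(∂S, ε)) / (2ε)` as `ε → 0+`. -/
def IsMinkowskiContent {d : ℕ} (S : Set (Euc d)) (L : ℝ) : Prop :=
  Tendsto (fun ε : ℝ => volFun (frontier S) ε / (2 * ε)) (𝓝[>] 0) (𝓝 L)

/-- The norm of `L²([a, b])`. -/
def l2Norm (a b : ℝ) (f : ℝ → ℝ) : ℝ :=
  Real.sqrt (∫ s in Set.Icc a b, f s ^ 2)

/-- `p` minimizes the `L²([a, b])` distance to `f` among the polynomials of degree at most `m`. -/
def IsBestApprox (f : ℝ → ℝ) (m : ℕ) (a b : ℝ) (p : ℝ[X]) : Prop :=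
  p.natDegree ≤ m ∧ ∀ q : ℝ[X], q.natDegree ≤ m →
    l2Norm a b (fun s => f s - p.eval s) ≤ l2Norm a b (fun s => f s - q.eval s)

/-- The best `L²([a, b])` approximation of `f` by polynomials of degree at most `m`. For `a < b` and
`f` square integrable on `[a, b]` (the only case of interest) it exists and is unique. -/
def bestApprox (f : ℝ → ℝ) (m : ℕ) (a b : ℝ) : ℝ[X] :=
  Classical.epsilon (IsBestApprox f m a b)

/-- The approximation error, the `L²([a, b])` norm of `f` minus its best approximation. -/
def approxError (f : ℝ → ℝ) (m : ℕ) (a b : ℝ) : ℝ :=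
  l2Norm a b (fun s => f s - (bestApprox f m a b).eval s)

/-- A grid `0 = r_0 < r_1 < ... < r_K` with `K ≥ 1`; the values `r i` with `i > K` play no role. -/
def IsGrid (r : ℕ → ℝ) (K : ℕ) : Prop :=
  1 ≤ K ∧ r 0 = 0 ∧ StrictMonoOn r (Set.Iic K)

/-- The threshold `U_n = (log n / n)^(1/(2d) - η)`. -/
def threshold (d : ℕ) (η : ℝ) (n : ℕ) : ℝ :=
  (Real.log n / n) ^ (1 / (2 * (d : ℝ)) - η)

/-- The ratio `c_i` of the approximation error of degree `d` on `I_i = [0, r_i]` to that of degree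
`ℓ` on `J_i = [r_i, r_K]`, with values in `[0, ∞]`: a positive number divided by `0` is `∞`. -/
def algRatio {d : ℕ} (A : Set (Euc d)) (r : ℕ → ℝ) (K ℓ i : ℕ) : ENNReal :=
  ENNReal.ofReal (approxError (volFun A) d 0 (r i)) /
    ENNReal.ofReal (approxError (volFun A) ℓ (r i) (r K))

open Classical in
/-- The output of the algorithm on the point set `A` with threshold `U`, grid `r` and degree `ℓ`. -/
def algOutput {d : ℕ} (A : Set (Euc d)) (U : ℝ) (r : ℕ → ℝ) (K ℓ : ℕ) : ℝ :=
  if U < approxError (volFun A) d 0 (r 1) then 0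
  else if h : ∃ i, 1 ≤ i ∧ i ≤ K - 1 ∧ 1 < algRatio A r K ℓ i then r (Nat.find h - 1)
  else r (K - 1)

/-- Hypothesis H1, with exponent parameter `η`, for a sequence of point sets `A n`: for all large `n`
the error of degree `d` on `I_i = [0, r_i]` is below the threshold whenever `I_i ⊆ [0, R]`. -/
def HypH1 {d : ℕ} (S : Set (Euc d)) (A : ℕ → Set (Euc d)) (r : ℕ → ℝ) (K : ℕ) (η : ℝ) : Prop :=
  ∀ᶠ n in atTop, ∀ i, 1 ≤ i → i ≤ K → (r i : EReal) ≤ polyReach S →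
    approxError (volFun (A n)) d 0 (r i) < threshold d η n

/-- Hypothesis H2 for a sequence of point sets `A n`, with `ℓ ε` as the degree chosen for `ε`. -/
def HypH2 {d : ℕ} (A : ℕ → Set (Euc d)) (r : ℕ → ℝ) (K : ℕ) (ℓ : ℝ → ℕ) : Prop :=
  ∀ ε > (0 : ℝ), d ≤ ℓ ε ∧ ∀ᶠ n in atTop, ∀ i, 1 ≤ i → i ≤ K - 1 →
    approxError (volFun (A n)) (ℓ ε) (r i) (r K) < ε

/-- The set formed by the first `n` points of a sequence. -/
def samplePts {d : ℕ} (x : ℕ → Euc d) (n : ℕ) : Set (Euc d) :=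
  x '' Set.Iio n

end

/-!
Write `V` for the volume function of `S` and `V_n` for that of the sample `ℵ_n`. Everything rests on
the estimate `‖V - V_n‖ = O(√ε_n)` in `L²` of any subinterval of `[0, r_K]`, where `ε_n` is a bound
for the Hausdorff distance of `ℵ_n ⊆ S` and `S` (`l2Norm_volFun_sub_le`). Indeed
`V_n t ≤ V t ≤ V_n (t + ε_n)`, so that `∫ (V - V_n)` telescopes and is at most `ε_n V(r_K)`, while
`0 ≤ V - V_n ≤ V(r_K)`. Monotonicity of the volume functions is all that enters; neither the
derivative of `V` at `0` nor the Minkowski content is needed for this rate.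

Standardness gives `ε_n = O((log n / n)^(1/d))` almost surely, by a packing bound and Borel–Cantelli
(`ae_eventually_subset_cthickening`); hence `‖V - V_n‖ = O((log n / n)^(1/(2d)))`, which is below the
threshold `(log n / n)^(1/(2d) - η)` for large `n`. The error of best approximation is `1`-Lipschitz
for the `L²` norm (`approxError_le_add`), so that the errors of `V_n` can be replaced by those of `V`:

* if `r_i ≤ R`, then `V` is a polynomial on `[0, r_i)` and its error on `[0, r_i]` is `0`, which gives
  H1;
* polynomials are dense in `L²` (`exists_approxError_lt`), which gives H2;
* if `r_j` is the first grid point beyond `R`, and `j < K`, then the error of `V` of degree `d` on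
  `[0, r_j]` is positive (`approxError_pos_of_polyReach_lt`), while for `ℓ` large the error of degree
  `ℓ` on `[r_j, r_K]` is smaller; hence `c_j > 1` for large `n`, and the algorithm returns a grid
  point before `r_j`.
-/

/-! ### Best polynomial approximation in `L²([a, b])` -/

lemma l2Norm_nonneg (a b : ℝ) (f : ℝ → ℝ) : 0 ≤ l2Norm a b f :=
  Real.sqrt_nonneg _

lemma l2Norm_eq_norm_toLp {a b : ℝ} {f : ℝ → ℝ}
    (hf : MemLp f 2 (volume.restrict (Set.Icc a b))) : l2Norm a b f = ‖hf.toLp f‖ := by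
  rw [Lp.norm_toLp, hf.eLpNorm_eq_integral_rpow_norm (by norm_num) (by norm_num),
    ENNReal.toReal_ofReal (by positivity), l2Norm, Real.sqrt_eq_rpow]
  simp

lemma l2Norm_add_le {a b : ℝ} {f g : ℝ → ℝ}
    (hf : MemLp f 2 (volume.restrict (Set.Icc a b)))
    (hg : MemLp g 2 (volume.restrict (Set.Icc a b))) :
    l2Norm a b (fun s => f s + g s) ≤ l2Norm a b f + l2Norm a b g := by
  change l2Norm a b (f + g) ≤ _
  rw [l2Norm_eq_norm_toLp hf, l2Norm_eq_norm_toLp hg, l2Norm_eq_norm_toLp (hf.add hg),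
    MemLp.toLp_add]
  exact norm_add_le _ _

lemma memLp_eval (p : ℝ[X]) (a b : ℝ) :
    MemLp (fun s => p.eval s) 2 (volume.restrict (Set.Icc a b)) := by
  obtain ⟨C, hC⟩ := isCompact_Icc.exists_bound_of_continuousOn (p.continuousOn (s := Set.Icc a b))
  refine MemLp.of_bound p.continuous.aestronglyMeasurable C ?_
  exact (ae_restrict_iff' measurableSet_Icc).2 (ae_of_all _ hC)

lemma Monotone.memLp_restrict_Icc {f : ℝ → ℝ} (hf : Monotone f) (a b : ℝ) :
    MemLp f 2 (volume.restrict (Set.Icc a b)) := by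
  refine MemLp.of_bound hf.measurable.aestronglyMeasurable (max |f a| |f b|) ?_
  refine (ae_restrict_iff' measurableSet_Icc).2 (ae_of_all _ fun x hx => ?_)
  exact abs_le_max_abs_abs (hf hx.1) (hf hx.2)

/-- Polynomials, regarded as elements of `L²([a, b])`. -/
noncomputable def polyToL2 (a b : ℝ) : ℝ[X] →ₗ[ℝ] Lp ℝ 2 (volume.restrict (Set.Icc a b)) where
  toFun p := (memLp_eval p a b).toLp _
  map_add' p q := by
    rw [← MemLp.toLp_add]
    congr 1
    ext s
    simp
  map_smul' c p := by
    rw [RingHom.id_apply, ← MemLp.toLp_const_smul]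
    congr 1
    ext s
    simp

lemma l2Norm_sub_eval {a b : ℝ} {f : ℝ → ℝ}
    (hf : MemLp f 2 (volume.restrict (Set.Icc a b))) (p : ℝ[X]) :
    l2Norm a b (fun s => f s - p.eval s) = ‖hf.toLp f - polyToL2 a b p‖ := by
  change l2Norm a b (f - fun s => p.eval s) = _
  rw [l2Norm_eq_norm_toLp (hf.sub (memLp_eval p a b)), MemLp.toLp_sub hf (memLp_eval p a b)]
  rfl

/-- A best approximation exists because the polynomials of degree at most `m` span a
finite-dimensional, hence complete, subspace of `L²`. -/
lemma exists_isBestApprox {a b : ℝ} {f : ℝ → ℝ}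
    (hf : MemLp f 2 (volume.restrict (Set.Icc a b))) (m : ℕ) :
    ∃ p, IsBestApprox f m a b p := by
  classical
  have hfin : FiniteDimensional ℝ (degreeLE ℝ (m : WithBot ℕ)) := by
    rw [degreeLE_eq_span_X_pow]
    exact FiniteDimensional.span_finset ℝ _
  obtain ⟨v, hv, hmin⟩ := Submodule.exists_norm_eq_iInf_of_complete_subspace
    ((degreeLE ℝ (m : WithBot ℕ)).map (polyToL2 a b))
    (Submodule.complete_of_finiteDimensional _) (hf.toLp f)
  obtain ⟨p, hp, rfl⟩ := hv
  refine ⟨p, natDegree_le_iff_degree_le.2 (mem_degreeLE.1 hp), fun q hq => ?_⟩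
  rw [l2Norm_sub_eval hf, l2Norm_sub_eval hf, hmin]
  exact ciInf_le (f := fun w : ((degreeLE ℝ (m : WithBot ℕ)).map (polyToL2 a b) :
      Set (Lp ℝ 2 (volume.restrict (Set.Icc a b)))) => ‖hf.toLp f - w‖)
    ⟨0, by rintro _ ⟨w, rfl⟩; exact norm_nonneg _⟩
    ⟨polyToL2 a b q, q, mem_degreeLE.2 (natDegree_le_iff_degree_le.1 hq), rfl⟩

lemma isBestApprox_bestApprox {a b : ℝ} {f : ℝ → ℝ}
    (hf : MemLp f 2 (volume.restrict (Set.Icc a b))) (m : ℕ) :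
    IsBestApprox f m a b (bestApprox f m a b) :=
  Classical.epsilon_spec (exists_isBestApprox hf m)

lemma approxError_le {a b : ℝ} {f : ℝ → ℝ}
    (hf : MemLp f 2 (volume.restrict (Set.Icc a b))) {m : ℕ} {q : ℝ[X]} (hq : q.natDegree ≤ m) :
    approxError f m a b ≤ l2Norm a b (fun s => f s - q.eval s) :=
  (isBestApprox_bestApprox hf m).2 q hq

lemma approxError_anti {a b : ℝ} {f : ℝ → ℝ}
    (hf : MemLp f 2 (volume.restrict (Set.Icc a b))) {m m' : ℕ} (h : m ≤ m') :
    approxError f m' a b ≤ approxError f m a b :=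
  approxError_le hf ((isBestApprox_bestApprox hf m).1.trans h)

/-- The approximation error is `1`-Lipschitz for the `L²` distance. -/
lemma approxError_le_add {a b : ℝ} {f g : ℝ → ℝ}
    (hf : MemLp f 2 (volume.restrict (Set.Icc a b)))
    (hg : MemLp g 2 (volume.restrict (Set.Icc a b))) (m : ℕ) :
    approxError f m a b ≤ l2Norm a b (fun s => f s - g s) + approxError g m a b := by
  refine (approxError_le hf (isBestApprox_bestApprox hg m).1).trans ?_
  refine le_trans (le_of_eq ?_) (l2Norm_add_le (hf.sub hg) (hg.sub (memLp_eval _ a b)))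
  congr 1
  ext s
  simp

lemma l2Norm_sub_comm (a b : ℝ) (f g : ℝ → ℝ) :
    l2Norm a b (fun s => f s - g s) = l2Norm a b (fun s => g s - f s) := by
  simp only [l2Norm, sub_sq_comm]

lemma l2Norm_le_of_abs_le {a b : ℝ} (hab : a ≤ b) {f : ℝ → ℝ} {c : ℝ} (hc : 0 ≤ c)
    (h : ∀ s ∈ Set.Icc a b, |f s| ≤ c) : l2Norm a b f ≤ c * √(b - a) := by
  have hint : ∫ s in Set.Icc a b, f s ^ 2 ≤ c ^ 2 * (b - a) := by
    have := norm_setIntegral_le_of_norm_le_const (f := fun s => f s ^ 2) (C := c ^ 2)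
      (s := Set.Icc a b) (μ := volume) (by simp) fun s hs => by
        rw [Real.norm_eq_abs, abs_of_nonneg (sq_nonneg _)]
        exact sq_le_sq' (by linarith [abs_le.1 (h s hs)]) (abs_le.1 (h s hs)).2
    rw [Real.volume_real_Icc_of_le hab] at this
    exact (le_abs_self _).trans this
  calc l2Norm a b f ≤ √(c ^ 2 * (b - a)) := Real.sqrt_le_sqrt hint
    _ = c * √(b - a) := by rw [Real.sqrt_mul (sq_nonneg c), Real.sqrt_sq hc]

/-- Density of the polynomials in `L²([a, b])`: continuous functions are dense, and polynomials
approximate them uniformly. -/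
lemma exists_approxError_lt {a b : ℝ} (hab : a ≤ b) {f : ℝ → ℝ}
    (hf : MemLp f 2 (volume.restrict (Set.Icc a b))) {ε : ℝ} (hε : 0 < ε) :
    ∃ m, approxError f m a b < ε := by
  obtain ⟨g, hfg, hg⟩ := hf.exists_boundedContinuous_eLpNorm_sub_le (by norm_num)
    (ε := ENNReal.ofReal (ε / 2)) (by simpa using hε)
  have hfg' : l2Norm a b (fun s => f s - g s) ≤ ε / 2 := by
    change l2Norm a b (f - g) ≤ _
    rw [l2Norm_eq_norm_toLp (hf.sub hg), Lp.norm_toLp]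
    exact ENNReal.toReal_le_of_le_ofReal (by positivity) hfg
  set c := ε / 2 / (√(b - a) + 1) with hc_def
  have hc : 0 < c := by positivity
  obtain ⟨p, hp⟩ := exists_polynomial_near_of_continuousOn a b g g.continuous.continuousOn c hc
  have hgp : l2Norm a b (fun s => g s - p.eval s) < ε / 2 := by
    refine (l2Norm_le_of_abs_le hab hc.le fun s hs => ?_).trans_lt ?_
    · rw [abs_sub_comm]
      exact (hp s hs).le
    · have : c * (√(b - a) + 1) = ε / 2 := div_mul_cancel₀ _ (by positivity)
      linarith
  refine ⟨p.natDegree, (approxError_le_add hf hg _).trans_lt ?_⟩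
  linarith [approxError_le hg (le_refl p.natDegree)]

lemma approxError_eq_zero {a b : ℝ} {f : ℝ → ℝ}
    (hf : MemLp f 2 (volume.restrict (Set.Icc a b))) {m : ℕ} {p : ℝ[X]} (hp : p.natDegree ≤ m)
    (h : ∀ s ∈ Set.Ico a b, f s = p.eval s) : approxError f m a b = 0 := by
  refine le_antisymm ((approxError_le hf hp).trans (le_of_eq ?_)) (l2Norm_nonneg _ _ _)
  rw [l2Norm, integral_Icc_eq_integral_Ico,
    setIntegral_congr_fun (g := fun _ => (0 : ℝ)) measurableSet_Ico]
  · simp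
  · intro s hs
    simp [h s hs]

lemma ae_eq_of_approxError_eq_zero {a b : ℝ} {f : ℝ → ℝ}
    (hf : MemLp f 2 (volume.restrict (Set.Icc a b))) {m : ℕ} (h : approxError f m a b = 0) :
    f =ᵐ[volume.restrict (Set.Icc a b)] fun s => (bestApprox f m a b).eval s := by
  have hz : ‖hf.toLp f - polyToL2 a b (bestApprox f m a b)‖ = 0 := by
    rw [← l2Norm_sub_eval hf]
    exact h
  have := sub_eq_zero.1 (norm_eq_zero.1 hz)
  exact (MemLp.toLp_eq_toLp_iff hf (memLp_eval _ a b)).1 this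

/-- Two functions that are continuous from the right and agree almost everywhere on `[a, b]` agree
on `[a, b)`. -/
lemma eq_of_ae_eq_of_continuousWithinAt_Ioi {a b : ℝ} {f g : ℝ → ℝ}
    (h : f =ᵐ[volume.restrict (Set.Icc a b)] g) {s : ℝ} (hs : s ∈ Set.Ico a b)
    (hf : ContinuousWithinAt f (Set.Ioi s) s) (hg : ContinuousWithinAt g (Set.Ioi s) s) :
    f s = g s := by
  -- The exceptional set is null, so it contains no interval `(s, u)`.
  have hfreq : ∃ᶠ t in 𝓝[>] s, f t = g t := by
    intro hev
    have hlt : ∀ᶠ t in 𝓝[>] s, t < b :=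
      Filter.mem_of_superset (Ioo_mem_nhdsGT hs.2) fun t ht => ht.2
    have hev' : ∀ᶠ t in 𝓝[>] s, t < b ∧ f t ≠ g t := hlt.and hev
    obtain ⟨u, hu, hsub⟩ := mem_nhdsGT_iff_exists_Ioo_subset.1 hev'
    have hnull := ae_iff.1 ((ae_restrict_iff' measurableSet_Icc).1 h)
    have hzero : volume (Set.Ioo s u) = 0 := by
      refine measure_mono_null (fun t ht => ?_) hnull
      have hmem : t ∈ Set.Icc a b := ⟨hs.1.trans ht.1.le, (hsub ht).1.le⟩
      exact fun hcontra => (hsub ht).2 (hcontra hmem)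
    rw [Real.volume_Ioo, ENNReal.ofReal_eq_zero] at hzero
    linarith [Set.mem_Ioi.1 hu]
  have hclosed := (hf.tendsto.sub hg.tendsto)
  have : f s - g s = 0 := by
    have hmem := isClosed_singleton (x := (0 : ℝ)) |>.mem_of_frequently_of_tendsto
      (hfreq.mono fun t ht => (by simp [ht] : f t - g t ∈ ({0} : Set ℝ))) hclosed
    simpa using hmem
  linarith

/-! ### Volume functions of nested sets -/

section VolFun

variable {d : ℕ} {A S : Set (Euc d)}

lemma volFun_nonneg (A : Set (Euc d)) (t : ℝ) : 0 ≤ volFun A t :=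
  ENNReal.toReal_nonneg

lemma volFun_le_volFun_of_cthickening_subset {s t : ℝ} (hS : Bornology.IsBounded S)
    (h : Metric.cthickening s A ⊆ Metric.cthickening t S) : volFun A s ≤ volFun S t :=
  ENNReal.toReal_mono hS.cthickening.measure_lt_top.ne (measure_mono h)

lemma monotone_volFun (hS : Bornology.IsBounded S) : Monotone (volFun S) := fun _ _ hst =>
  volFun_le_volFun_of_cthickening_subset hS (Metric.cthickening_mono hst S)

lemma volFun_mono_set (hS : Bornology.IsBounded S) (hAS : A ⊆ S) (t : ℝ) :
    volFun A t ≤ volFun S t :=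
  volFun_le_volFun_of_cthickening_subset hS (Metric.cthickening_subset_of_subset t hAS)

lemma volFun_le_volFun_add (hA : Bornology.IsBounded A) {ε t : ℝ} (hε : 0 ≤ ε) (ht : 0 ≤ t)
    (h : S ⊆ Metric.cthickening ε A) : volFun S t ≤ volFun A (t + ε) :=
  volFun_le_volFun_of_cthickening_subset hA
    ((Metric.cthickening_subset_of_subset t h).trans (Metric.cthickening_cthickening_subset ht hε A))

lemma continuousWithinAt_volFun_Ioi (hS : Bornology.IsBounded S) (t : ℝ) :
    ContinuousWithinAt (volFun S) (Set.Ioi t) t := by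
  refine (ENNReal.tendsto_toReal hS.cthickening.measure_lt_top.ne).comp ?_
  change Tendsto _ _ (𝓝 (volume (Metric.cthickening t S)))
  rw [Metric.cthickening_eq_iInter_cthickening S]
  exact tendsto_measure_biInter_gt (fun s _ => Metric.isClosed_cthickening.nullMeasurableSet)
    (fun _ _ _ hij => Metric.cthickening_mono hij S)
    ⟨t + 1, by simp, hS.cthickening.measure_lt_top.ne⟩

/-- Since `V_S (t - ε) ≤ V_A t` and `V_S` is monotone, the integral telescopes. -/
lemma setIntegral_volFun_sub_le (hS : Bornology.IsBounded S) (hAS : A ⊆ S) {ε b : ℝ} (hε : 0 ≤ ε)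
    (hb : 0 ≤ b) (h : S ⊆ Metric.cthickening ε A) :
    ∫ t in (0 : ℝ)..b, (volFun S t - volFun A t) ≤ ε * volFun S b := by
  have hSm := monotone_volFun hS
  have hAm := monotone_volFun (hS.subset hAS)
  have hSi : ∀ x y, IntervalIntegrable (volFun S) volume x y := fun x y => hSm.intervalIntegrable
  have hAi : ∀ x y, IntervalIntegrable (volFun A) volume x y := fun x y => hAm.intervalIntegrable
  rcases le_total b ε with hbε | hεb
  · calc ∫ t in (0 : ℝ)..b, (volFun S t - volFun A t) ≤ ∫ _ in (0 : ℝ)..b, volFun S b := by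
          refine intervalIntegral.integral_mono_on hb ((hSi _ _).sub (hAi _ _))
            intervalIntegrable_const fun t ht => ?_
          linarith [hSm ht.2, volFun_nonneg A t]
      _ = b * volFun S b := by simp
      _ ≤ ε * volFun S b := by gcongr; exact volFun_nonneg S b
  · have h1 : ∫ t in (0 : ℝ)..(b - ε), volFun S t ≤ ∫ t in ε..b, volFun A t := by
      have hshift : ∫ t in (0 : ℝ)..(b - ε), volFun A (t + ε) = ∫ t in ε..b, volFun A t := by
        rw [intervalIntegral.integral_comp_add_right (fun t => volFun A t)]
        simp
      rw [← hshift]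
      refine intervalIntegral.integral_mono_on (by linarith) (hSi _ _) ?_ fun t ht =>
        volFun_le_volFun_add (hS.subset hAS) hε ht.1 h
      exact (show Monotone fun t => volFun A (t + ε) from
        fun x y hxy => hAm (by linarith)).intervalIntegrable
    have h2 : 0 ≤ ∫ t in (0 : ℝ)..ε, volFun A t :=
      intervalIntegral.integral_nonneg hε fun t _ => volFun_nonneg A t
    have h3 : ∫ t in (b - ε)..b, volFun S t ≤ ε * volFun S b := by
      calc ∫ t in (b - ε)..b, volFun S t ≤ ∫ _ in (b - ε)..b, volFun S b :=
            intervalIntegral.integral_mono_on (by linarith) (hSi _ _) intervalIntegrable_const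
              fun t ht => hSm ht.2
        _ = ε * volFun S b := by simp
    rw [intervalIntegral.integral_sub (hSi _ _) (hAi _ _),
      ← intervalIntegral.integral_add_adjacent_intervals (hSi 0 (b - ε)) (hSi (b - ε) b),
      ← intervalIntegral.integral_add_adjacent_intervals (hAi 0 ε) (hAi ε b)]
    linarith

/-- The `L²` distance of the volume functions of two sets at Hausdorff distance at most `ε` is of
order `√ε`; only the monotonicity of the volume functions is needed. -/
lemma l2Norm_volFun_sub_le (hS : Bornology.IsBounded S) (hAS : A ⊆ S) {ε a b c : ℝ} (hε : 0 ≤ ε)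
    (ha : 0 ≤ a) (hab : a ≤ b) (hbc : b ≤ c) (h : S ⊆ Metric.cthickening ε A) :
    l2Norm a b (fun t => volFun S t - volFun A t) ≤ volFun S c * √ε := by
  have hSm := monotone_volFun hS
  have hAm := monotone_volFun (hS.subset hAS)
  have hb := ha.trans hab
  have hD : ∀ t, 0 ≤ volFun S t - volFun A t := fun t => sub_nonneg.2 (volFun_mono_set hS hAS t)
  have hsq : ∀ x y, IntegrableOn (fun t => (volFun S t - volFun A t) ^ 2) (Set.Icc x y) :=
    fun x y => ((hSm.memLp_restrict_Icc x y).sub (hAm.memLp_restrict_Icc x y)).integrable_sq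
  have hint : ∫ t in Set.Icc a b, (volFun S t - volFun A t) ^ 2 ≤ volFun S b ^ 2 * ε := by
    calc ∫ t in Set.Icc a b, (volFun S t - volFun A t) ^ 2
        ≤ ∫ t in Set.Icc 0 b, (volFun S t - volFun A t) ^ 2 :=
          setIntegral_mono_set (hsq 0 b) (ae_of_all _ fun t => sq_nonneg _)
            (Set.Icc_subset_Icc_left ha).eventuallyLE
      _ = ∫ t in (0 : ℝ)..b, (volFun S t - volFun A t) ^ 2 := by
          rw [intervalIntegral.integral_of_le hb, integral_Icc_eq_integral_Ioc]
      _ ≤ ∫ t in (0 : ℝ)..b, volFun S b * (volFun S t - volFun A t) := by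
          refine intervalIntegral.integral_mono_on hb ?_ ?_ fun t ht => ?_
          · exact (intervalIntegrable_iff_integrableOn_Icc_of_le hb).2 (hsq 0 b)
          · exact (hSm.intervalIntegrable.sub hAm.intervalIntegrable).const_mul _
          · rw [sq]
            exact mul_le_mul_of_nonneg_right (by linarith [hSm ht.2, volFun_nonneg A t]) (hD t)
      _ ≤ volFun S b * (ε * volFun S b) := by
          rw [intervalIntegral.integral_const_mul]
          exact mul_le_mul_of_nonneg_left (setIntegral_volFun_sub_le hS hAS hε hb h)
            (volFun_nonneg S b)
      _ = volFun S b ^ 2 * ε := by ring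
  calc l2Norm a b (fun t => volFun S t - volFun A t) ≤ √(volFun S b ^ 2 * ε) :=
        Real.sqrt_le_sqrt hint
    _ = volFun S b * √ε := by rw [Real.sqrt_mul (sq_nonneg _), Real.sqrt_sq (volFun_nonneg S b)]
    _ ≤ volFun S c * √ε := by gcongr; exact hSm hbc

end VolFun

/-! ### The polynomial reach -/

section PolyReach

variable {d : ℕ} {S : Set (Euc d)}

lemma IsPolyOn.mono {V : ℝ → ℝ} {m : ℕ} {s t : ℝ} (h : IsPolyOn V m t) (hst : s ≤ t) :
    IsPolyOn V m s := by
  obtain ⟨p, hp, hV⟩ := h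
  exact ⟨p, hp, fun u hu => hV u ⟨hu.1, hu.2.trans hst⟩⟩

lemma le_polyReach_of_isPolyOn {t : ℝ} (ht : 0 ≤ t) (h : IsPolyOn (volFun S) d t) :
    (t : EReal) ≤ polyReach S :=
  le_sSup ⟨t, ⟨ht, h⟩, rfl⟩

lemma polyReach_nonneg (S : Set (Euc d)) : 0 ≤ polyReach S := by
  refine le_polyReach_of_isPolyOn (t := 0) le_rfl ⟨C (volFun S 0), by simp, fun s hs => ?_⟩
  rw [le_antisymm hs.2 hs.1, eval_C]

/-- The polynomials representing `V` on the intervals `[0, t]` with `t < r` all coincide, because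
they agree on `[0, r / 2]`. -/
lemma exists_poly_of_le_polyReach {r : ℝ} (hr : 0 < r) (h : (r : EReal) ≤ polyReach S) :
    ∃ p : ℝ[X], p.natDegree ≤ d ∧ ∀ s ∈ Set.Ico 0 r, volFun S s = p.eval s := by
  have hpoly : ∀ t < r, IsPolyOn (volFun S) d t := by
    intro t ht
    obtain ⟨_, ⟨u, ⟨-, hu⟩, rfl⟩, htu⟩ :=
      lt_sSup_iff.1 ((EReal.coe_lt_coe_iff.2 ht).trans_le h)
    exact hu.mono (EReal.coe_lt_coe_iff.1 htu).le
  obtain ⟨p, hp, hpV⟩ := hpoly (r / 2) (by linarith)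
  refine ⟨p, hp, fun s hs => ?_⟩
  obtain ⟨q, -, hqV⟩ := hpoly (max s (r / 2)) (max_lt hs.2 (by linarith))
  have hpq : p = q := by
    refine eq_of_infinite_eval_eq p q ((Set.Icc_infinite (by linarith : (0 : ℝ) < r / 2)).mono ?_)
    intro u hu
    change p.eval u = q.eval u
    rw [← hpV u hu, ← hqV u ⟨hu.1, hu.2.trans (le_max_right _ _)⟩]
  rw [hpq]
  exact hqV s ⟨hs.1, le_max_left _ _⟩

lemma le_polyReach_of_eqOn_Ico {r : ℝ} {p : ℝ[X]} (hp : p.natDegree ≤ d)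
    (h : ∀ s ∈ Set.Ico 0 r, volFun S s = p.eval s) : (r : EReal) ≤ polyReach S := by
  by_contra! hlt
  obtain ⟨c, hc, hcr⟩ := EReal.lt_iff_exists_real_btwn.1 hlt
  have hc0 : 0 ≤ c := EReal.coe_nonneg.1 ((polyReach_nonneg S).trans hc.le)
  exact hc.not_ge (le_polyReach_of_isPolyOn hc0
    ⟨p, hp, fun s hs => h s ⟨hs.1, hs.2.trans_lt (EReal.coe_lt_coe_iff.1 hcr)⟩⟩)

/-- Beyond the polynomial reach the approximation error is positive: if it vanished, `V` would be
almost everywhere a polynomial on `[0, r]`, and hence everywhere on `[0, r)` by right continuity. -/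
lemma approxError_pos_of_polyReach_lt (hS : Bornology.IsBounded S) {r : ℝ}
    (h : polyReach S < (r : EReal)) : 0 < approxError (volFun S) d 0 r := by
  have hL := (monotone_volFun hS).memLp_restrict_Icc 0 r
  refine lt_of_le_of_ne (l2Norm_nonneg _ _ _) fun hzero => ?_
  have hae := ae_eq_of_approxError_eq_zero hL hzero.symm
  refine h.not_ge (le_polyReach_of_eqOn_Ico (isBestApprox_bestApprox hL d).1 fun s hs => ?_)
  exact eq_of_ae_eq_of_continuousWithinAt_Ioi hae hs (continuousWithinAt_volFun_Ioi hS s)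
    (Polynomial.continuous _).continuousWithinAt

end PolyReach

/-! ### Covering the support by the sample -/

/-- Under standardness with respect to Lebesgue measure, a ball of small radius `ε` centred in `S`
has mass at least a multiple of `ε ^ d`. -/
lemma IsStandard.exists_pow_le_measure_closedBall {d : ℕ} {S : Set (Euc d)} {ν : Measure (Euc d)}
    (h : IsStandard S ν) :
    ∃ lam > (0 : ℝ), ∃ a > (0 : ℝ), ∀ x ∈ S, ∀ ε : ℝ, 0 < ε → ε ≤ lam →
      ENNReal.ofReal (a * ε ^ d) ≤ ν (Metric.closedBall x ε) := by
  obtain ⟨lam, hlam, δ, hδ, H⟩ := h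
  have hfin : volume (Metric.ball (0 : Euc d) 1) ≠ ⊤ := measure_ball_lt_top.ne
  have hpos : 0 < volume (Metric.ball (0 : Euc d) 1) := Metric.measure_ball_pos _ _ one_pos
  refine ⟨lam, hlam, δ * (volume (Metric.ball (0 : Euc d) 1)).toReal,
    mul_pos hδ (ENNReal.toReal_pos hpos.ne' hfin), fun x hx ε hε hεl => ?_⟩
  refine le_trans (le_of_eq ?_) ((H x hx ε hε hεl).trans (measure_mono Set.inter_subset_left))
  rw [Measure.addHaar_closedBall _ _ hε.le, finrank_euclideanSpace_fin,
    ENNReal.ofReal_mul (by positivity), ENNReal.ofReal_mul hδ.le, ENNReal.ofReal_toReal hfin]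
  ring

/-- The packing bound: if balls of radius `ε / 2` centred in `S` have mass at least `c` for a
probability measure, then a maximal `ε`-separated subset of `S` has at most `1 / c` points, and it
is an `ε`-net. -/
lemma exists_finset_net {α : Type*} [MetricSpace α] [MeasurableSpace α] [OpensMeasurableSpace α]
    {S : Set α} (ν : Measure α) [IsProbabilityMeasure ν] {ε c : ℝ} (hε : 0 < ε) (hc : 0 < c)
    (h : ∀ x ∈ S, ENNReal.ofReal c ≤ ν (Metric.closedBall x (ε / 2))) :
    ∃ T : Finset α, (T : Set α) ⊆ S ∧ (∀ y ∈ S, ∃ x ∈ T, dist y x ≤ ε) ∧ (T.card : ℝ) * c ≤ 1 := by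
  classical
  let sep : Finset α → Prop := fun T => (T : Set α) ⊆ S ∧ ∀ x ∈ T, ∀ y ∈ T, x ≠ y → ε < dist x y
  have hcard : ∀ T, sep T → (T.card : ℝ) * c ≤ 1 := by
    rintro T ⟨hTS, hT⟩
    have hdisj : (T : Set α).PairwiseDisjoint fun x => Metric.closedBall x (ε / 2) := by
      intro x hx y hy hxy
      exact Metric.closedBall_disjoint_closedBall (by linarith [hT x hx y hy hxy])
    have hsum : ∑ x ∈ T, ν (Metric.closedBall x (ε / 2)) ≤ 1 := by
      rw [← measure_biUnion_finset hdisj fun x _ => Metric.isClosed_closedBall.measurableSet]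
      exact prob_le_one
    have := (Finset.sum_le_sum fun x hx => h x (hTS hx)).trans hsum
    rw [Finset.sum_const, nsmul_eq_mul, ← ENNReal.ofReal_natCast,
      ← ENNReal.ofReal_mul (by positivity)] at this
    exact ENNReal.ofReal_le_one.1 this
  -- The cardinalities of separated subsets are bounded, so one of them is largest.
  have hfin : {k : ℕ | ∃ T, sep T ∧ T.card = k}.Finite := by
    refine (Set.finite_Iic ⌊1 / c⌋₊).subset ?_
    rintro _ ⟨T, hT, rfl⟩
    exact Nat.le_floor ((le_div_iff₀ hc).2 (hcard T hT))
  have hne : {k : ℕ | ∃ T, sep T ∧ T.card = k}.Nonempty := ⟨0, ∅, by simp [sep], by simp⟩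
  obtain ⟨k, ⟨T, hT, rfl⟩, hmax⟩ := Set.exists_max_image _ id hfin hne
  refine ⟨T, hT.1, fun y hy => ?_, hcard T hT⟩
  by_contra! hfar
  have hyT : y ∉ T := fun hyT => by
    have := hfar y hyT
    rw [dist_self] at this
    linarith
  have hins : sep (insert y T) := by
    refine ⟨?_, fun u hu v hv huv => ?_⟩
    · rw [Finset.coe_insert]
      exact Set.insert_subset hy hT.1
    · rcases Finset.mem_insert.1 hu with rfl | huT <;> rcases Finset.mem_insert.1 hv with rfl | hvT
      · exact absurd rfl huv
      · exact hfar v hvT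
      · rw [dist_comm]
        exact hfar u huT
      · exact hT.2 u huT v hvT huv
  have := hmax _ ⟨_, hins, rfl⟩
  simp [Finset.card_insert_of_notMem hyT] at this

lemma measure_forall_notMem_le {α Ω : Type*} [MeasurableSpace α] {ν : Measure α}
    [IsProbabilityMeasure ν] [MeasurableSpace Ω] {P : Measure Ω} [IsProbabilityMeasure P]
    {X : ℕ → Ω → α} (hXm : ∀ k, Measurable (X k)) (hXlaw : ∀ k, P.map (X k) = ν)
    (hXind : iIndepFun X P) {B : Set α} (hB : MeasurableSet B) {q : ℝ}
    (hq : ENNReal.ofReal q ≤ ν B) (n : ℕ) :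
    P {ω | ∀ k < n, X k ω ∉ B} ≤ ENNReal.ofReal (Real.exp (-(n * q))) := by
  have hset : {ω | ∀ k < n, X k ω ∉ B} = ⋂ k ∈ Finset.range n, X k ⁻¹' Bᶜ := by
    ext ω
    simp
  have hcompl : ν Bᶜ ≤ ENNReal.ofReal (Real.exp (-q)) := by
    rw [prob_compl_eq_one_sub hB, tsub_le_iff_right]
    calc (1 : ENNReal) = ENNReal.ofReal 1 := by simp
      _ ≤ ENNReal.ofReal (Real.exp (-q) + q) :=
        ENNReal.ofReal_le_ofReal (by linarith [Real.add_one_le_exp (-q)])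
      _ ≤ ENNReal.ofReal (Real.exp (-q)) + ENNReal.ofReal q := ENNReal.ofReal_add_le
      _ ≤ _ := by gcongr
  rw [hset, hXind.measure_inter_preimage_eq_mul _ fun k _ => hB.compl]
  calc ∏ k ∈ Finset.range n, P (X k ⁻¹' Bᶜ) = (ν Bᶜ) ^ n := by
        rw [Finset.prod_congr rfl fun k _ => by
          rw [← Measure.map_apply (hXm k) hB.compl, hXlaw k]]
        simp
    _ ≤ ENNReal.ofReal (Real.exp (-q)) ^ n := by gcongr
    _ = ENNReal.ofReal (Real.exp (-(n * q))) := by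
        rw [← ENNReal.ofReal_pow (Real.exp_nonneg _), ← Real.exp_nat_mul]
        ring_nf

/-- The covering radius `(3 log n / (a n)) ^ (1 / d)`, chosen so that a ball of this radius has mass
at least `3 log n / n` when balls of radius `ε` have mass at least `a * ε ^ d`. -/
noncomputable def coverRadius (d : ℕ) (a : ℝ) (n : ℕ) : ℝ :=
  (3 / a * (Real.log n / n)) ^ (1 / (d : ℝ))

lemma tendsto_log_div_natCast : Tendsto (fun n : ℕ => Real.log n / n) atTop (𝓝 0) := by
  have := (Real.isLittleO_log_id_atTop.tendsto_div_nhds_zero).comp tendsto_natCast_atTop_atTop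
  simpa [Function.comp_def] using this

lemma coverRadius_pow {d : ℕ} (hd : 1 ≤ d) {a : ℝ} (ha : 0 < a) (n : ℕ) :
    coverRadius d a n ^ d = 3 / a * (Real.log n / n) := by
  have hlog : 0 ≤ Real.log n := Real.log_natCast_nonneg n
  rw [coverRadius, one_div, Real.rpow_inv_natCast_pow (by positivity) (by omega)]

lemma tendsto_coverRadius {d : ℕ} (hd : 1 ≤ d) (a : ℝ) :
    Tendsto (coverRadius d a) atTop (𝓝 0) := by
  have h := (tendsto_log_div_natCast.const_mul (3 / a)).rpow_const (p := 1 / (d : ℝ))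
    (Or.inr (by positivity))
  rwa [mul_zero, Real.zero_rpow (by positivity)] at h

lemma coverRadius_pos (d : ℕ) {a : ℝ} (ha : 0 < a) {n : ℕ} (hn : 2 ≤ n) :
    0 < coverRadius d a n := by
  have hlog : 0 < Real.log n := Real.log_pos (by exact_mod_cast hn)
  have : 0 < (n : ℝ) := by positivity
  exact Real.rpow_pos_of_pos (by positivity) _

/-- Almost surely the first `n` points eventually form a net of `S` of mesh `2 ρ_n`, where
`ρ_n ^ d = 3 log n / (a n)`. A net of `S` of mesh `ρ_n` with at most `2 ^ d n` points exists by
packing; each of its balls is missed by the sample with probability at most `n⁻³`, and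
Borel–Cantelli concludes. -/
lemma ae_eventually_subset_cthickening {d : ℕ} (hd : 1 ≤ d) {S : Set (Euc d)}
    {ν : Measure (Euc d)} [IsProbabilityMeasure ν] {Ω : Type*} [MeasurableSpace Ω] {P : Measure Ω}
    [IsProbabilityMeasure P] {X : ℕ → Ω → Euc d} (hXm : ∀ k, Measurable (X k))
    (hXlaw : ∀ k, P.map (X k) = ν) (hXind : iIndepFun X P) {lam a : ℝ} (hlam : 0 < lam)
    (ha : 0 < a) (H : ∀ x ∈ S, ∀ ε : ℝ, 0 < ε → ε ≤ lam →
      ENNReal.ofReal (a * ε ^ d) ≤ ν (Metric.closedBall x ε)) :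
    ∀ᵐ ω ∂P, ∀ᶠ n in atTop,
      S ⊆ Metric.cthickening (2 * coverRadius d a n) (samplePts (fun k => X k ω) n) := by
  obtain ⟨N, hN⟩ : ∃ N, ∀ n ≥ N, 3 ≤ n ∧ coverRadius d a n ≤ lam :=
    eventually_atTop.1 ((eventually_ge_atTop 3).and
      ((tendsto_coverRadius hd a).eventually (ge_mem_nhds hlam)))
  have hnet : ∀ n, ∃ T : Finset (Euc d), N ≤ n →
      ((T : Set (Euc d)) ⊆ S ∧ (∀ y ∈ S, ∃ x ∈ T, dist y x ≤ coverRadius d a n) ∧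
        (T.card : ℝ) * (a * (coverRadius d a n / 2) ^ d) ≤ 1) := by
    intro n
    by_cases hn : N ≤ n
    · have hpos := coverRadius_pos d ha (n := n) (by have := (hN n hn).1; omega)
      obtain ⟨T, hT⟩ := exists_finset_net (S := S) ν hpos
        (c := a * (coverRadius d a n / 2) ^ d) (by positivity)
        fun x hx => H x hx _ (by positivity) (by linarith [(hN n hn).2])
      exact ⟨T, fun _ => hT⟩
    · exact ⟨∅, fun h => absurd h hn⟩
  choose T hT using hnet
  let bad : ℕ → Set Ω := fun n => if N ≤ n then
    ⋃ x ∈ T n, {ω | ∀ k < n, X k ω ∉ Metric.closedBall x (coverRadius d a n)} else ∅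
  have hbad : ∀ n, P (bad n) ≤ ENNReal.ofReal (2 ^ d * (1 / (n : ℝ) ^ 2)) := by
    intro n
    by_cases hn : N ≤ n
    swap
    · simp [bad, hn]
    obtain ⟨hn3, hnlam⟩ := hN n hn
    obtain ⟨hTS, -, hTc⟩ := hT n hn
    have hpos := coverRadius_pos d ha (n := n) (by omega)
    have hn0 : 0 < (n : ℝ) := by positivity
    have hlog : 1 ≤ Real.log n := by
      rw [Real.le_log_iff_exp_le hn0]
      have : (3 : ℝ) ≤ n := by exact_mod_cast hn3
      linarith [Real.exp_one_lt_d9]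
    -- The packing bound is `card * (3 log n) ≤ 2 ^ d * n`, and `1 ≤ log n`.
    have hcard : ((T n).card : ℝ) ≤ 2 ^ d * n := by
      rw [div_pow, coverRadius_pow hd ha] at hTc
      have h1 : a * (3 / a * (Real.log n / n) / 2 ^ d) = 3 * Real.log n / (2 ^ d * n) := by
        field_simp
      rw [h1, mul_div_assoc', div_le_one (by positivity)] at hTc
      nlinarith [Nat.cast_nonneg (α := ℝ) (T n).card]
    have hexp : Real.exp (-(n * (a * coverRadius d a n ^ d))) = 1 / (n : ℝ) ^ 3 := by
      rw [coverRadius_pow hd ha]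
      have h1 : (n : ℝ) * (a * (3 / a * (Real.log n / n))) = Real.log ((n : ℝ) ^ 3) := by
        rw [Real.log_pow]
        field_simp
        norm_num
      rw [h1, Real.exp_neg, Real.exp_log (by positivity), one_div]
    simp only [bad, hn, if_true]
    calc P (⋃ x ∈ T n, {ω | ∀ k < n, X k ω ∉ Metric.closedBall x (coverRadius d a n)})
        ≤ ∑ x ∈ T n, P {ω | ∀ k < n, X k ω ∉ Metric.closedBall x (coverRadius d a n)} :=
          measure_biUnion_finset_le _ _
      _ ≤ ∑ x ∈ T n, ENNReal.ofReal (1 / (n : ℝ) ^ 3) := by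
          refine Finset.sum_le_sum fun x hx => ?_
          rw [← hexp]
          exact measure_forall_notMem_le hXm hXlaw hXind
            Metric.isClosed_closedBall.measurableSet (H x (hTS hx) _ hpos hnlam) n
      _ = ENNReal.ofReal ((T n).card * (1 / (n : ℝ) ^ 3)) := by
          rw [Finset.sum_const, nsmul_eq_mul, ENNReal.ofReal_mul (by positivity),
            ENNReal.ofReal_natCast]
      _ ≤ ENNReal.ofReal (2 ^ d * (1 / (n : ℝ) ^ 2)) := by
          refine ENNReal.ofReal_le_ofReal ?_
          calc ((T n).card : ℝ) * (1 / (n : ℝ) ^ 3) ≤ 2 ^ d * n * (1 / (n : ℝ) ^ 3) := by gcongr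
            _ = 2 ^ d * (1 / (n : ℝ) ^ 2) := by field_simp
  have hsum : ∑' n, P (bad n) ≠ ⊤ := by
    refine ne_top_of_le_ne_top ?_ (ENNReal.tsum_le_tsum hbad)
    exact ((Real.summable_one_div_nat_pow.2 one_lt_two).mul_left _).tsum_ofReal_ne_top
  filter_upwards [ae_eventually_notMem hsum] with ω hω
  filter_upwards [hω, eventually_ge_atTop N] with n hn hnN y hy
  simp only [bad, hnN, if_true, Set.mem_iUnion, Set.mem_ofPred_eq, not_exists, not_forall,
    not_not] at hn
  obtain ⟨x, hxT, hyx⟩ := (hT n hnN).2.1 y hy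
  obtain ⟨k, hk, hkx⟩ := hn x hxT
  refine Metric.mem_cthickening_of_dist_le y (X k ω) _ _ ⟨k, hk, rfl⟩ ?_
  calc dist y (X k ω) ≤ dist y x + dist x (X k ω) := dist_triangle _ _ _
    _ ≤ 2 * coverRadius d a n := by
      rw [dist_comm x]
      linarith [Metric.mem_closedBall.1 hkx]

/-! ### The three conclusions for sets converging to `S` -/

lemma IsGrid.le {r : ℕ → ℝ} {K : ℕ} (hr : IsGrid r K) {i j : ℕ} (hij : i ≤ j) (hj : j ≤ K) :
    r i ≤ r j :=
  hr.2.2.monotoneOn (Set.mem_Iic.2 (hij.trans hj)) (Set.mem_Iic.2 hj) hij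

lemma IsGrid.nonneg {r : ℕ → ℝ} {K : ℕ} (hr : IsGrid r K) {i : ℕ} (hi : i ≤ K) : 0 ≤ r i :=
  hr.2.1 ▸ hr.le (Nat.zero_le i) hi

lemma IsGrid.pos {r : ℕ → ℝ} {K : ℕ} (hr : IsGrid r K) {i : ℕ} (hi : 1 ≤ i) (hiK : i ≤ K) :
    0 < r i := by
  rw [← hr.2.1]
  exact hr.2.2 (Set.mem_Iic.2 (Nat.zero_le K)) (Set.mem_Iic.2 hiK) hi

/-- A multiple of the square root of the covering radius is below the threshold: both are powers of
`log n / n`, with exponents `1 / (2d)` and `1 / (2d) - η`. -/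
lemma eventually_mul_sqrt_coverRadius_lt_threshold (d : ℕ) {a : ℝ} (ha : 0 < a) {η : ℝ}
    (hη : 0 < η) (W : ℝ) :
    ∀ᶠ n in atTop, W * √(2 * coverRadius d a n) < threshold d η n := by
  have hlim : Tendsto (fun n : ℕ =>
      W * √(2 * (3 / a) ^ (1 / (d : ℝ))) * (Real.log n / n) ^ η) atTop (𝓝 0) := by
    have := (tendsto_log_div_natCast.rpow_const (p := η) (Or.inr hη.le)).const_mul
      (W * √(2 * (3 / a) ^ (1 / (d : ℝ))))
    rwa [Real.zero_rpow hη.ne', mul_zero] at this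
  filter_upwards [hlim.eventually (gt_mem_nhds one_pos), eventually_ge_atTop 2] with n hn hn2
  have hx : 0 < Real.log n / n :=
    div_pos (Real.log_pos (by exact_mod_cast hn2)) (by positivity)
  have hsqrt : √(2 * coverRadius d a n) =
      √(2 * (3 / a) ^ (1 / (d : ℝ))) * (Real.log n / n) ^ (1 / (2 * (d : ℝ))) := by
    rw [coverRadius, Real.mul_rpow (by positivity) hx.le, ← mul_assoc,
      Real.sqrt_mul (by positivity), Real.sqrt_eq_rpow ((Real.log n / n) ^ (1 / (d : ℝ))),
      ← Real.rpow_mul hx.le]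
    congr 2
    ring
  rw [hsqrt, threshold, sub_eq_neg_add, Real.rpow_add hx, Real.rpow_neg hx.le, ← mul_assoc]
  refine mul_lt_mul_of_pos_right ?_ (Real.rpow_pos_of_pos hx _)
  rwa [← one_div, lt_div_iff₀ (Real.rpow_pos_of_pos hx _)]

section Convergence

variable {d : ℕ} {S : Set (Euc d)} {A : ℕ → Set (Euc d)} {r : ℕ → ℝ} {K : ℕ}

lemma hypH1_of_subset_cthickening (hS : Bornology.IsBounded S) (hr : IsGrid r K)
    (hAS : ∀ n, A n ⊆ S) {a : ℝ} (ha : 0 < a)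
    (hcov : ∀ᶠ n in atTop, S ⊆ Metric.cthickening (2 * coverRadius d a n) (A n))
    {η : ℝ} (hη : 0 < η) : HypH1 S A r K η := by
  filter_upwards [hcov, eventually_ge_atTop 2,
    eventually_mul_sqrt_coverRadius_lt_threshold d ha hη (volFun S (r K))]
    with n hn hn2 hlt i hi hiK hiR
  have hρ := coverRadius_pos d ha hn2
  have hSL := (monotone_volFun hS).memLp_restrict_Icc 0 (r i)
  have hAL := (monotone_volFun (hS.subset (hAS n))).memLp_restrict_Icc 0 (r i)
  obtain ⟨p, hp, hpV⟩ := exists_poly_of_le_polyReach (hr.pos hi hiK) hiR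
  refine ((approxError_le_add hAL hSL d).trans ?_).trans_lt hlt
  rw [approxError_eq_zero hSL hp hpV, add_zero, l2Norm_sub_comm]
  exact l2Norm_volFun_sub_le hS (hAS n) (by positivity) le_rfl (hr.nonneg hiK) (hr.le hiK le_rfl) hn

/-- If the sets `A n` converge to `S`, their volume functions converge in `L²`, uniformly over the
subintervals of `[0, c]`. -/
lemma eventually_l2Norm_volFun_sub_lt (hS : Bornology.IsBounded S) (hAS : ∀ n, A n ⊆ S)
    {e : ℕ → ℝ} (he : Tendsto e atTop (𝓝 0)) (he0 : ∀ᶠ n in atTop, 0 ≤ e n)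
    (hcov : ∀ᶠ n in atTop, S ⊆ Metric.cthickening (e n) (A n)) (c : ℝ) {ε : ℝ} (hε : 0 < ε) :
    ∀ᶠ n in atTop, ∀ a b, 0 ≤ a → a ≤ b → b ≤ c →
      l2Norm a b (fun t => volFun S t - volFun (A n) t) < ε := by
  have hlim : Tendsto (fun n => volFun S c * √(e n)) atTop (𝓝 0) := by
    have := (Real.continuous_sqrt.tendsto 0).comp he |>.const_mul (volFun S c)
    rwa [Real.sqrt_zero, mul_zero] at this
  filter_upwards [hcov, he0, hlim.eventually (gt_mem_nhds hε)] with n hn hn0 hlt a b ha hab hbc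
  exact (l2Norm_volFun_sub_le hS (hAS n) hn0 ha hab hbc hn).trans_lt hlt

/-- A degree that achieves error below `ε` for the limit `V` on all the intervals `J_i`. -/
lemma exists_degree_approxError_lt (hS : Bornology.IsBounded S) (hr : IsGrid r K) {ε : ℝ}
    (hε : 0 < ε) :
    ∃ m, d ≤ m ∧ ∀ i, 1 ≤ i → i ≤ K - 1 → approxError (volFun S) m (r i) (r K) < ε := by
  have hex : ∀ i, ∃ m, i ≤ K → approxError (volFun S) m (r i) (r K) < ε := by
    intro i
    by_cases hi : i ≤ K
    · obtain ⟨m, hm⟩ := exists_approxError_lt (hr.le hi le_rfl)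
        ((monotone_volFun hS).memLp_restrict_Icc (r i) (r K)) hε
      exact ⟨m, fun _ => hm⟩
    · exact ⟨0, fun h => absurd h hi⟩
  choose m hm using hex
  refine ⟨max d ((Finset.range (K + 1)).sup m), le_max_left _ _, fun i _ hi => ?_⟩
  refine (approxError_anti ((monotone_volFun hS).memLp_restrict_Icc _ _) ?_).trans_lt
    (hm i (by omega))
  exact (Finset.le_sup (f := m) (Finset.mem_range.2 (by omega))).trans (le_max_right _ _)

lemma hypH2_of_subset_cthickening (hS : Bornology.IsBounded S) (hr : IsGrid r K)
    (hAS : ∀ n, A n ⊆ S) {e : ℕ → ℝ} (he : Tendsto e atTop (𝓝 0)) (he0 : ∀ᶠ n in atTop, 0 ≤ e n)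
    (hcov : ∀ᶠ n in atTop, S ⊆ Metric.cthickening (e n) (A n)) {ℓ : ℝ → ℕ}
    (hℓ : ∀ ε > 0, d ≤ ℓ ε ∧
      ∀ i, 1 ≤ i → i ≤ K - 1 → approxError (volFun S) (ℓ ε) (r i) (r K) < ε / 2) :
    HypH2 A r K ℓ := by
  refine fun ε hε => ⟨(hℓ ε hε).1, ?_⟩
  filter_upwards [eventually_l2Norm_volFun_sub_lt hS hAS he he0 hcov (r K) (half_pos hε)]
    with n hn i hi hiK
  have h1 := hn (r i) (r K) (hr.nonneg (by omega)) (hr.le (by omega) le_rfl) le_rfl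
  rw [l2Norm_sub_comm] at h1
  have h2 := approxError_le_add ((monotone_volFun (hS.subset (hAS n))).memLp_restrict_Icc _ _)
    ((monotone_volFun hS).memLp_restrict_Icc (r i) (r K)) (ℓ ε)
  linarith [(hℓ ε hε).2 i hi hiK]

/-- The output is at most `R` if the grid points before the index `j` are at most `R` and the
algorithm stops at `j` at the latest. -/
lemma algOutput_le {B : Set (Euc d)} {U : ℝ} {ℓ j : ℕ} {R : EReal} (hr : IsGrid r K)
    (hj : 1 ≤ j) (hR : ∀ i < j, (r i : EReal) ≤ R)
    (hlast : j = K ∨ j ≤ K - 1 ∧ 1 < algRatio B r K ℓ j) :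
    (algOutput B U r K ℓ : EReal) ≤ R := by
  classical
  unfold algOutput
  split_ifs with h1 h2
  · exact hr.2.1 ▸ hR 0 hj
  · refine hR _ ?_
    have hspec := Nat.find_spec h2
    rcases hlast with rfl | ⟨hjK, hratio⟩
    · omega
    · have := Nat.find_min' h2 ⟨hj, hjK, hratio⟩
      omega
  · rcases hlast with rfl | ⟨hjK, hratio⟩
    · exact hR _ (by omega)
    · exact absurd ⟨j, hj, hjK, hratio⟩ h2

/-- The first grid point `r_j` beyond the reach, if there is one with `j < K`, stops the algorithm:
the error of degree `d` on `[0, r_j]` stays away from `0`, whereas that of degree `ℓ` on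
`[r_j, r_K]` is small. Grid points before `r_j` are within the reach. -/
lemma exists_degree_algOutput_le_polyReach (hS : Bornology.IsBounded S) (hr : IsGrid r K) :
    ∃ ℓ₀ : ℕ, d ≤ ℓ₀ ∧ ∀ ℓ ≥ ℓ₀, ∀ A : ℕ → Set (Euc d), (∀ n, A n ⊆ S) →
      ∀ e : ℕ → ℝ, Tendsto e atTop (𝓝 0) → (∀ᶠ n in atTop, 0 ≤ e n) →
      (∀ᶠ n in atTop, S ⊆ Metric.cthickening (e n) (A n)) →
      ∀ᶠ n in atTop, ∀ U : ℝ, (algOutput (A n) U r K ℓ : EReal) ≤ polyReach S := by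
  classical
  by_cases hex : ∃ j, 1 ≤ j ∧ j ≤ K - 1 ∧ polyReach S < r j
  swap
  · push Not at hex
    -- If `r_1, …, r_{K-1}` are all within the reach, any output of the algorithm is.
    refine ⟨d, le_rfl, fun ℓ _ A _ e _ _ _ => Eventually.of_forall fun n U => ?_⟩
    refine algOutput_le hr hr.1 (fun i hi => ?_) (Or.inl rfl)
    rcases Nat.eq_zero_or_pos i with rfl | hi0
    · rw [hr.2.1]
      exact polyReach_nonneg S
    · exact hex i hi0 (by omega)
  obtain ⟨hj1, hjK, hjR⟩ := Nat.find_spec hex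
  have hmin : ∀ i < Nat.find hex, (r i : EReal) ≤ polyReach S := by
    intro i hi
    rcases Nat.eq_zero_or_pos i with rfl | hi0
    · rw [hr.2.1]
      exact polyReach_nonneg S
    · have := Nat.find_min hex hi
      push Not at this
      exact this hi0 (by omega)
  generalize Nat.find hex = j at hj1 hjK hjR hmin
  have hδ := approxError_pos_of_polyReach_lt hS hjR
  set δ := approxError (volFun S) d 0 (r j)
  -- With `δ / 4` both for the degree `m` and for the distance of `V_n` to `V`, the numerator of the
  -- ratio at `j` exceeds `3 δ / 4` and its denominator stays below `δ / 2`.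
  obtain ⟨m, hdm, hm⟩ := exists_degree_approxError_lt hS hr (by positivity : 0 < δ / 4)
  refine ⟨m, hdm, fun ℓ hℓ A hAS e he he0 hcov => ?_⟩
  filter_upwards [eventually_l2Norm_volFun_sub_lt hS hAS he he0 hcov (r K)
    (by positivity : 0 < δ / 4)] with n hn U
  refine algOutput_le hr hj1 hmin (Or.inr ⟨hjK, ?_⟩)
  have hSm := monotone_volFun hS
  have hAm := monotone_volFun (hS.subset (hAS n))
  have hnum : δ < δ / 4 + approxError (volFun (A n)) d 0 (r j) :=
    (approxError_le_add (hSm.memLp_restrict_Icc _ _) (hAm.memLp_restrict_Icc 0 (r j)) d).trans_lt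
      (add_lt_add_left (hn _ _ le_rfl (hr.nonneg (by omega)) (hr.le (by omega) le_rfl)) _)
  have hden : approxError (volFun (A n)) ℓ (r j) (r K) < δ / 2 := by
    have h1 := hn (r j) (r K) (hr.nonneg (by omega)) (hr.le (by omega) le_rfl) le_rfl
    rw [l2Norm_sub_comm] at h1
    have h2 := approxError_le_add (hAm.memLp_restrict_Icc _ _)
      (hSm.memLp_restrict_Icc (r j) (r K)) ℓ
    linarith [hm j hj1 hjK, approxError_anti (hSm.memLp_restrict_Icc (r j) (r K)) hℓ]
  have hlt : ENNReal.ofReal (approxError (volFun (A n)) ℓ (r j) (r K)) <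
      ENNReal.ofReal (approxError (volFun (A n)) d 0 (r j)) :=
    (ENNReal.ofReal_lt_ofReal_iff (by linarith)).2 (by linarith)
  rw [algRatio, ENNReal.lt_div_iff_mul_lt (Or.inr ENNReal.one_ne_top)
    (Or.inl ENNReal.ofReal_ne_top),
    one_mul]
  exact hlt

end Convergence

theorem mainTheorem3 {d : ℕ} (hd : 1 ≤ d)
    (S : Set (Euc d)) (hS : IsCompact S)
    (hV0 : 0 < volFun S 0)
    (hV' : ∃ v : ℝ, HasDerivWithinAt (volFun S) v (Set.Ici 0) 0)
    (hL : ∃ L : ℝ, IsMinkowskiContent S L)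
    (ν : Measure (Euc d)) [IsProbabilityMeasure ν] (hνS : ν Sᶜ = 0) (hν : IsStandard S ν)
    {Ω : Type*} [MeasurableSpace Ω] (P : Measure Ω) [IsProbabilityMeasure P]
    (X : ℕ → Ω → Euc d) (hXm : ∀ k, Measurable (X k))
    (hXlaw : ∀ k, P.map (X k) = ν) (hXind : iIndepFun X P)
    (r : ℕ → ℝ) (K : ℕ) (hr : IsGrid r K) :
    (∀ η > (0 : ℝ), ∀ᵐ ω ∂P, HypH1 S (samplePts (fun k => X k ω)) r K η) ∧
    (∃ ℓ : ℝ → ℕ, ∀ᵐ ω ∂P, HypH2 (samplePts (fun k => X k ω)) r K ℓ) ∧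
    (∃ ℓ₀ : ℕ, d ≤ ℓ₀ ∧ ∀ ℓ ≥ ℓ₀, ∀ η > (0 : ℝ), ∀ᵐ ω ∂P, ∀ᶠ n in atTop,
      ((algOutput (samplePts (fun k => X k ω) n) (threshold d η n) r K ℓ : ℝ) : EReal)
        ≤ polyReach S) := by
  obtain ⟨lam, hlam, a, ha, hmass⟩ := hν.exists_pow_le_measure_closedBall
  have hcov := ae_eventually_subset_cthickening hd hXm hXlaw hXind hlam ha hmass
  have hsub : ∀ᵐ ω ∂P, ∀ n, samplePts (fun k => X k ω) n ⊆ S := by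
    have hmem : ∀ᵐ ω ∂P, ∀ k, X k ω ∈ S := by
      refine ae_all_iff.2 fun k => ae_of_ae_map (hXm k).aemeasurable ?_
      rw [hXlaw k]
      exact hνS
    filter_upwards [hmem] with ω hω n
    rintro _ ⟨k, -, rfl⟩
    exact hω k
  have he : Tendsto (fun n => 2 * coverRadius d a n) atTop (𝓝 0) := by
    simpa using (tendsto_coverRadius hd a).const_mul 2
  have he0 : ∀ᶠ n in atTop, 0 ≤ 2 * coverRadius d a n := by
    filter_upwards [eventually_ge_atTop 2] with n hn
    linarith [coverRadius_pos d ha hn]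
  refine ⟨fun η hη => ?_, ?_, ?_⟩
  · filter_upwards [hcov, hsub] with ω h1 h2
    exact hypH1_of_subset_cthickening hS.isBounded hr h2 ha h1 hη
  · have hdeg : ∀ ε : ℝ, ∃ m, ε > 0 → d ≤ m ∧
        ∀ i, 1 ≤ i → i ≤ K - 1 → approxError (volFun S) m (r i) (r K) < ε / 2 := by
      intro ε
      by_cases hε : 0 < ε
      · obtain ⟨m, hm⟩ := exists_degree_approxError_lt hS.isBounded hr (half_pos hε)
        exact ⟨m, fun _ => hm⟩
      · exact ⟨0, fun h => absurd h hε⟩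
    choose ℓ hℓ using hdeg
    refine ⟨ℓ, ?_⟩
    filter_upwards [hcov, hsub] with ω h1 h2
    exact hypH2_of_subset_cthickening hS.isBounded hr h2 he he0 h1 hℓ
  · obtain ⟨ℓ₀, hdℓ, hℓ⟩ := exists_degree_algOutput_le_polyReach hS.isBounded hr
    refine ⟨ℓ₀, hdℓ, fun ℓ hℓ' η _ => ?_⟩
    filter_upwards [hcov, hsub] with ω h1 h2
    filter_upwards [hℓ ℓ hℓ' _ h2 _ he he0 h1] with n hn
    exact hn _
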